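/- Let $(\Omega,\mathcal F,\mathbb P)$ be a probability space and let $\{\emptyset,\Omega\}=\mathcal F_0\subseteq\mathcal F_1\subseteq\mathcal F_2\subseteq\cdots$ be sub-$\sigma$-algebras of $\mathcal F$ with $\mathcal F=\sigma\big(\bigcup_n\mathcal F_n\big)$, each purely atomic, i.e. generated by a countable partition $\mathscr A_n$ of $\Omega$ into sets of positive measure (its atoms); we call $(\Omega,\mathcal F,(\mathcal F_n),\mathbb P)$ a filtered probability space. For every $n\ge 0$ and $A\in\mathscr A_n$ fix an atom $A^*\in\mathscr A_{n+1}$ of maximal measure among the atoms of $\mathcal F_{n+1}$ contained in $A$ (ties may be broken arbitrarily). Let $\mathscr E$ be the collection consisting of $\Omega$ and, for all $n\ge0$ and $A\in\mathscr A_n$, of all $B\in\mathscr A_{n+1}$ with $B\subseteq A$ and $B\ne A^*$, and let $$[\mathscr E]=\sup_{I\in\mathscr E}\frac1{\mathbb P(I)}\sum_{J\in\mathscr E,\;J\subseteq I}\mathbb P(J)$$ be its Carleson constant. For $1<p\le 2$ let $MT_p(\mathbb R)$ be the smallest constant $C$ such that, for every filtered probability space and every real-valued $f\in L^p$, $$\|f\|_{p}\le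 C\Big(|\mathbb E f|^p+\sum_{n=1}^\infty\big\|\mathbb E[f|\mathcal F_n]-\mathbb E[f|\mathcal F_{n-1}]\big\|_{p}^p\Big)^{1/p}.$$ Let $1<p\le2$ and suppose $[\mathscr E]<\infty$. Then the constant $$T_p=\Big(2+\frac1{1-2^{-1/p}}\Big)\,2^{2-\frac1p}\,\big(1+MT_p(\mathbb R)^p\big)^{1/p}\,\big(4[\mathscr E]+1\big)^{1-\frac1p}$$ is finite, and for every Banach space $X$ and every $f\in L^p(\Omega,\mathcal F,\mathbb P;X)$, $$\|f\|_{L^p(\Omega,X)}\le T_p\Big(\|\mathbb E f\|_X^p+\sum_{n=1}^\infty\big\|\mathbb E[f|\mathcal F_n]-\mathbb E[f|\mathcal F_{n-1}]\big\|_{L^p(\Omega,X)}^p\Big)^{1/p}.$$ -/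

import Mathlib

open MeasureTheory
open scoped ENNReal

universe u v

/-- The atoms of a `σ`-algebra `m`: the minimal nonempty `m`-measurable sets. -/
def atomsOf {Ω : Type u} (m : MeasurableSpace Ω) : Set (Set Ω) :=
  {A | MeasurableSet[m] A ∧ A.Nonempty ∧ ∀ B, MeasurableSet[m] B → B ⊆ A → B = ∅ ∨ B = A}

/-- `m` is purely atomic with respect to `μ`: `Ω` is the union of the atoms of `m`, and each atom
has positive measure. For a finite `μ` the atoms then form a countable partition of `Ω`, which
generates `m`. -/
def IsPurelyAtomic {Ω : Type u} {mΩ : MeasurableSpace Ω} (μ : Measure Ω)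
    (m : MeasurableSpace Ω) : Prop :=
  ⋃₀ atomsOf m = Set.univ ∧ ∀ A ∈ atomsOf m, 0 < μ A

/-- `(Ω, 𝓕, (𝓕ₙ), ℙ)` is a filtered probability space (for a probability measure `μ`):
the `𝓕ₙ` increase (part of `Filtration`), are purely atomic and generate the whole `σ`-algebra.
The filtration starts from the trivial `σ`-algebra `𝓕₀ = {∅, Ω}`. -/
structure IsFilteredProbabilitySpace {Ω : Type u} {mΩ : MeasurableSpace Ω} (μ : Measure Ω)
    (ℱ : Filtration ℕ mΩ) : Prop where
  zero_eq : ℱ 0 = ⊥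
  purelyAtomic : ∀ n, IsPurelyAtomic μ (ℱ n)
  iSup_eq : ⨆ n, (ℱ n : MeasurableSpace Ω) = mΩ

/-- `star n A` is a largest atom of `𝓕ₙ₊₁` contained in `A`, for every `n` and every atom `A` of
`𝓕ₙ`. Ties may be broken in any way. -/
def IsLargestChild {Ω : Type u} {mΩ : MeasurableSpace Ω} (μ : Measure Ω)
    (ℱ : Filtration ℕ mΩ) (star : ℕ → Set Ω → Set Ω) : Prop :=
  ∀ n, ∀ A ∈ atomsOf (ℱ n), star n A ∈ atomsOf (ℱ (n + 1)) ∧ star n A ⊆ A ∧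
    ∀ B ∈ atomsOf (ℱ (n + 1)), B ⊆ A → μ B ≤ μ (star n A)

/-- The collection `𝓔` of atoms that are not selected as largest children: it consists of `Ω` and,
for every atom `A` of some `𝓕ₙ`, of all atoms of `𝓕ₙ₊₁` contained in `A` except `star n A`. -/
def unstarredAtoms {Ω : Type u} {mΩ : MeasurableSpace Ω} (ℱ : Filtration ℕ mΩ)
    (star : ℕ → Set Ω → Set Ω) : Set (Set Ω) :=
  {B | B = Set.univ ∨
    ∃ n, ∃ A ∈ atomsOf (ℱ n), B ∈ atomsOf (ℱ (n + 1)) ∧ B ⊆ A ∧ B ≠ star n A}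

/-- The Carleson constant of a collection `R` of sets. -/
noncomputable def carlesonConst {Ω : Type u} {mΩ : MeasurableSpace Ω} (μ : Measure Ω)
    (R : Set (Set Ω)) : ℝ≥0∞ :=
  ⨆ I ∈ R, (μ I)⁻¹ * ∑' J : {J : Set Ω // J ∈ R ∧ J ⊆ I}, μ (J : Set Ω)

/-- `(‖𝔼 f‖ ^ p + ∑_{n ≥ 1} ‖𝔼[f|𝓕ₙ] - 𝔼[f|𝓕ₙ₋₁]‖_p ^ p) ^ (1 / p)`. -/
noncomputable def martingaleDiffNorm {Ω : Type u} {mΩ : MeasurableSpace Ω} {X : Type v}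
    [NormedAddCommGroup X] [NormedSpace ℝ X] [CompleteSpace X] (μ : Measure Ω)
    (ℱ : Filtration ℕ mΩ) (p : ℝ) (f : Ω → X) : ℝ≥0∞ :=
  (‖∫ ω, f ω ∂μ‖ₑ ^ p +
    ∑' n : ℕ, eLpNorm (μ[f|ℱ (n + 1)] - μ[f|ℱ n]) (ENNReal.ofReal p) μ ^ p) ^ (1 / p)

/-- The martingale type `p` constant `MT_p(X)`: the smallest constant in the upper `ℓ^p` estimates,
valid for all filtered probability spaces; it is `∞` if there is no finite one. -/
noncomputable def martingaleTypeConst.{w, z} (p : ℝ) (X : Type z)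
    [NormedAddCommGroup X] [NormedSpace ℝ X] [CompleteSpace X] : ℝ≥0∞ :=
  sInf {C : ℝ≥0∞ | ∀ (Ω : Type w) (mΩ : MeasurableSpace Ω) (μ : Measure Ω)
    (ℱ : Filtration ℕ mΩ), IsProbabilityMeasure μ → IsFilteredProbabilitySpace μ ℱ →
    ∀ f : Ω → X, MemLp f (ENNReal.ofReal p) μ →
      eLpNorm f (ENNReal.ofReal p) μ ≤ C * martingaleDiffNorm μ ℱ p f}

/-- `(2 + 1 / (1 - 2^{-1/p})) 2^{2 - 1/p} (1 + M^p)^{1/p} (4 c + 1)^{1 - 1/p}`. -/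
noncomputable def upperConst (p : ℝ) (M c : ℝ≥0∞) : ℝ≥0∞ :=
  ENNReal.ofReal ((2 + 1 / (1 - (2 : ℝ) ^ (-(1 / p)))) * (2 : ℝ) ^ (2 - 1 / p)) *
    (1 + M ^ p) ^ (1 / p) * (4 * c + 1) ^ (1 - 1 / p)

/-
Write `H N` for the sum of the norms of the first `N + 1` martingale differences `d k`. Since
`d (n + 1)` has mean zero on every atom `A` of `ℱ n` and is constant on the selected child of `A`,
its `L¹` norm on `A` is at most twice the one on `A ∩ U n`, where `U n` is the union of the
unselected atoms of `ℱ (n + 1)`. Expanding `H (n + 1) ^ p` around `H n` therefore produces cross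
terms that live on `U n` only, and Young's inequality bounds them by a multiple of
`‖d (n + 1)‖ ^ p` plus a small multiple of `H n ^ p` on `U n`. By Carleson's embedding the latter
sum up to a small multiple of `∫ H N ^ p`, which is absorbed, so that `‖H N‖_p` is controlled by
the differences in every Banach space; Lévy's theorem lets `N` tend to infinity. The finiteness of
`MT_p(ℝ)` comes from the parallelogram law, which gives
`‖x + y‖ ^ p + ‖x - y‖ ^ p ≤ 2 * (‖x‖ ^ p + ‖y‖ ^ p)` in every Hilbert space.
-/

section Atoms

variable {Ω : Type u} {m m₁ m₂ mΩ : MeasurableSpace Ω} {μ : Measure Ω}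

theorem subset_or_disjoint_of_mem_atomsOf {A S : Set Ω} (hA : A ∈ atomsOf m)
    (hS : MeasurableSet[m] S) : A ⊆ S ∨ Disjoint A S := by
  rcases hA.2.2 (A ∩ S) (hA.1.inter hS) Set.inter_subset_left with h | h
  · exact Or.inr (Set.disjoint_iff_inter_eq_empty.2 h)
  · exact Or.inl (Set.inter_eq_left.1 h)

theorem subset_of_mem_atomsOf (hm : m₁ ≤ m₂) {A B : Set Ω} (hA : A ∈ atomsOf m₁)
    (hB : B ∈ atomsOf m₂) {x : Ω} (hxA : x ∈ A) (hxB : x ∈ B) : B ⊆ A :=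
  (subset_or_disjoint_of_mem_atomsOf hB (hm A hA.1)).resolve_right
    fun h => Set.disjoint_left.1 h hxB hxA

theorem eq_of_mem_atomsOf {A B : Set Ω} (hA : A ∈ atomsOf m) (hB : B ∈ atomsOf m) {x : Ω}
    (hxA : x ∈ A) (hxB : x ∈ B) : A = B :=
  (subset_of_mem_atomsOf le_rfl hB hA hxB hxA).antisymm
    (subset_of_mem_atomsOf le_rfl hA hB hxA hxB)

theorem pairwiseDisjoint_atomsOf (m : MeasurableSpace Ω) : (atomsOf m).PairwiseDisjoint id :=
  fun _ hA _ hB hAB => Set.disjoint_left.2 fun _ hxA hxB => hAB (eq_of_mem_atomsOf hA hB hxA hxB)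

theorem apply_eq_of_mem_atomsOf {E : Type*} [TopologicalSpace E]
    [TopologicalSpace.MetrizableSpace E] {f : Ω → E} (hf : StronglyMeasurable[m] f) {A : Set Ω}
    (hA : A ∈ atomsOf m) {x y : Ω} (hx : x ∈ A) (hy : y ∈ A) : f y = f x := by
  have hS : MeasurableSet[m] {z | f z = f x} := hf.measurableSet_eq_fun stronglyMeasurable_const
  exact (subset_or_disjoint_of_mem_atomsOf hA hS).resolve_right
    (fun h => Set.disjoint_left.1 h hx rfl) hy

theorem IsPurelyAtomic.exists_mem (h : IsPurelyAtomic μ m) (x : Ω) : ∃ A ∈ atomsOf m, x ∈ A :=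
  Set.mem_sUnion.1 (h.1.symm ▸ Set.mem_univ x)

theorem IsPurelyAtomic.countable_atomsOf [SFinite μ] (h : IsPurelyAtomic μ m) (hm : m ≤ mΩ) :
    (atomsOf m).Countable := by
  have hpos : {A : atomsOf m | 0 < μ (A : Set Ω)}.Countable :=
    Measure.countable_meas_pos_of_disjoint_iUnion (fun A => hm _ A.2.1)
      fun A B hAB => pairwiseDisjoint_atomsOf m A.2 B.2 (Subtype.coe_ne_coe.2 hAB)
  exact Set.countable_coe_iff.1 (Set.countable_univ_iff.1 (hpos.mono fun A _ => h.2 A A.2))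

theorem IsPurelyAtomic.measure_le_of_forall_atomsOf [SFinite μ] (h : IsPurelyAtomic μ m)
    (hm : m ≤ mΩ) {ν₁ ν₂ : Measure Ω} (hν : ∀ A ∈ atomsOf m, ν₁ A ≤ ν₂ A) {S : Set Ω}
    (hS : MeasurableSet[m] S) : ν₁ S ≤ ν₂ S := by
  have hunion : S = ⋃₀ {A ∈ atomsOf m | A ⊆ S} := by
    refine subset_antisymm (fun x hx => ?_) (Set.sUnion_subset fun A hA => hA.2)
    obtain ⟨A, hA, hxA⟩ := h.exists_mem x
    exact ⟨A, ⟨hA, (subset_or_disjoint_of_mem_atomsOf hA hS).resolve_right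
      fun hd => Set.disjoint_left.1 hd hxA hx⟩, hxA⟩
  have hcount : {A ∈ atomsOf m | A ⊆ S}.Countable :=
    (h.countable_atomsOf hm).mono (Set.sep_subset _ _)
  have hmeas : ∀ A ∈ {A ∈ atomsOf m | A ⊆ S}, MeasurableSet A := fun A hA => hm A hA.1.1
  have hdisj : {A ∈ atomsOf m | A ⊆ S}.PairwiseDisjoint id :=
    (pairwiseDisjoint_atomsOf m).subset (Set.sep_subset _ _)
  rw [hunion, measure_sUnion hcount hdisj hmeas, measure_sUnion hcount hdisj hmeas]
  exact ENNReal.tsum_le_tsum fun A => hν A A.2.1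

end Atoms

section CarlesonSequences

variable {Ω : Type*} {m mΩ : MeasurableSpace Ω} {μ : Measure Ω} {ℱ : Filtration ℕ mΩ}

theorem lintegral_le_lintegral_of_forall_measurableSet (hm : m ≤ mΩ)
    {ν₁ ν₂ : Measure Ω} (h : ∀ A, MeasurableSet[m] A → ν₁ A ≤ ν₂ A) {g : Ω → ℝ≥0∞}
    (hg : Measurable[m] g) : ∫⁻ x, g x ∂ν₁ ≤ ∫⁻ x, g x ∂ν₂ := by
  rw [← lintegral_trim hm hg, ← lintegral_trim hm hg]
  refine lintegral_mono' (Measure.le_iff.2 fun A hA => ?_) le_rfl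
  rw [trim_measurableSet_eq hm hA, trim_measurableSet_eq hm hA]
  exact h A hA

/-- The Carleson packing condition for a sequence of sets `U n`, in its local form: the part of
the family from level `k` on has mass at most `c * μ A` within every `A ∈ ℱ k`. In the application
`U n` is only `ℱ (n + 1)`-measurable. -/
def IsCarlesonSequence (μ : Measure Ω) (ℱ : Filtration ℕ mΩ) (U : ℕ → Set Ω) (c : ℝ≥0∞) : Prop :=
  ∀ k A, MeasurableSet[ℱ k] A → ∑' n, μ (U (k + n) ∩ A) ≤ c * μ A

theorem exists_measurable_increments {h : ℕ → Ω → ℝ≥0∞} (hmeas : ∀ n, Measurable[ℱ n] (h n))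
    (hmono : Monotone h) :
    ∃ g : ℕ → Ω → ℝ≥0∞, (∀ n, Measurable[ℱ n] (g n)) ∧
      ∀ n, h n = ∑ k ∈ Finset.range (n + 1), g k := by
  refine ⟨fun | 0 => h 0 | n + 1 => h (n + 1) - h n, ?_, fun n => ?_⟩
  · rintro (_ | n)
    · exact hmeas 0
    · exact (hmeas (n + 1)).sub ((hmeas n).mono (ℱ.mono n.le_succ) le_rfl)
  · induction n with
    | zero => simp
    | succ n ih =>
      rw [Finset.sum_range_succ, ← ih]
      exact (add_tsub_cancel_of_le (hmono n.le_succ)).symm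

theorem IsCarlesonSequence.sum_setLIntegral_le {U : ℕ → Set Ω} {c : ℝ≥0∞}
    (hU : IsCarlesonSequence μ ℱ U c) (k N : ℕ) {g : Ω → ℝ≥0∞} (hg : Measurable[ℱ k] g) :
    ∑ n ∈ Finset.Ico k N, ∫⁻ x in U n, g x ∂μ ≤ c * ∫⁻ x, g x ∂μ := by
  rw [← lintegral_finsetSum_measure, ← smul_eq_mul, ← lintegral_smul_measure]
  refine lintegral_le_lintegral_of_forall_measurableSet (ℱ.le k) (fun A hA => ?_) hg
  calc (∑ n ∈ Finset.Ico k N, μ.restrict (U n)) A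
      = ∑ n ∈ Finset.range (N - k), μ (U (k + n) ∩ A) := by
        simp only [Measure.finsetSum_apply, Measure.restrict_apply (ℱ.le k A hA),
          Finset.sum_Ico_eq_sum_range, Set.inter_comm A]
    _ ≤ ∑' n, μ (U (k + n) ∩ A) := ENNReal.sum_le_tsum _
    _ ≤ (c • μ) A := hU k A hA

-- Carleson's embedding: sum by parts, and apply the packing condition to every increment of the
-- increasing process `h`.
theorem IsCarlesonSequence.sum_setLIntegral_le_of_monotone {U : ℕ → Set Ω} {c : ℝ≥0∞}
    (hU : IsCarlesonSequence μ ℱ U c) {h : ℕ → Ω → ℝ≥0∞} (hmeas : ∀ n, Measurable[ℱ n] (h n))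
    (hmono : Monotone h) (N : ℕ) :
    ∑ n ∈ Finset.range N, ∫⁻ x in U n, h n x ∂μ ≤ c * ∫⁻ x, h N x ∂μ := by
  obtain ⟨g, hg, hsum⟩ := exists_measurable_increments hmeas hmono
  have hg' : ∀ n, Measurable (g n) := fun n => (hg n).mono (ℱ.le n) le_rfl
  have hlint : ∀ (ν : Measure Ω) (n : ℕ),
      ∫⁻ x, h n x ∂ν = ∑ k ∈ Finset.range (n + 1), ∫⁻ x, g k x ∂ν := fun ν n => by
    simp only [hsum, Finset.sum_apply]
    exact lintegral_finsetSum _ fun k _ => hg' k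
  calc ∑ n ∈ Finset.range N, ∫⁻ x in U n, h n x ∂μ
      = ∑ k ∈ Finset.range N, ∑ n ∈ Finset.Ico k N, ∫⁻ x in U n, g k x ∂μ := by
        simp only [hlint, Finset.range_eq_Ico]
        exact Finset.sum_comm' fun n k => by simp only [Finset.mem_Ico]; omega
    _ ≤ ∑ k ∈ Finset.range (N + 1), ∑ n ∈ Finset.Ico k N, ∫⁻ x in U n, g k x ∂μ :=
        Finset.sum_le_sum_of_subset (Finset.range_subset_range.2 N.le_succ)
    _ ≤ ∑ k ∈ Finset.range (N + 1), c * ∫⁻ x, g k x ∂μ :=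
        Finset.sum_le_sum fun k _ => hU.sum_setLIntegral_le k N (hg k)
    _ = c * ∫⁻ x, h N x ∂μ := by rw [← Finset.mul_sum, hlint]

end CarlesonSequences

section UnstarredSets

variable {Ω : Type u} {mΩ : MeasurableSpace Ω} {μ : Measure Ω} {ℱ : Filtration ℕ mΩ}
  {star : ℕ → Set Ω → Set Ω}

/-- `star` selects a child `star n A` of every atom `A` of `ℱ n`, that is, an atom of `ℱ (n + 1)`
contained in `A`; unlike in `IsLargestChild`, any child may be selected. -/
def IsChildSelection (ℱ : Filtration ℕ mΩ) (star : ℕ → Set Ω → Set Ω) : Prop :=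
  ∀ n, ∀ A ∈ atomsOf (ℱ n), star n A ∈ atomsOf (ℱ (n + 1)) ∧ star n A ⊆ A

/-- The atoms of `ℱ (n + 1)` that are not the selected child of an atom of `ℱ n`: the members of
`unstarredAtoms` at level `n + 1`. -/
def unstarredChildren (ℱ : Filtration ℕ mΩ) (star : ℕ → Set Ω → Set Ω) (n : ℕ) : Set (Set Ω) :=
  {B | B ∈ atomsOf (ℱ (n + 1)) ∧ ∃ A ∈ atomsOf (ℱ n), B ⊆ A ∧ B ≠ star n A}

/-- The union of the unstarred atoms of `ℱ (n + 1)`. -/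
def unstarredSet (ℱ : Filtration ℕ mΩ) (star : ℕ → Set Ω → Set Ω) (n : ℕ) : Set Ω :=
  ⋃₀ unstarredChildren ℱ star n

theorem IsLargestChild.isChildSelection (h : IsLargestChild μ ℱ star) : IsChildSelection ℱ star :=
  fun n A hA => ⟨(h n A hA).1, (h n A hA).2.1⟩

theorem countable_unstarredChildren [SFinite μ] {n : ℕ} (hn : IsPurelyAtomic μ (ℱ (n + 1))) :
    (unstarredChildren ℱ star n).Countable :=
  (hn.countable_atomsOf (ℱ.le _)).mono fun _ hB => hB.1

theorem measurableSet_unstarredSet [SFinite μ] {n : ℕ} (hn : IsPurelyAtomic μ (ℱ (n + 1))) :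
    MeasurableSet[ℱ (n + 1)] (unstarredSet ℱ star n) :=
  MeasurableSet.sUnion (countable_unstarredChildren hn) fun _ hB => hB.1.1

theorem unstarredChildren_subset_unstarredAtoms (n : ℕ) :
    unstarredChildren ℱ star n ⊆ unstarredAtoms ℱ star :=
  fun _ ⟨hB, A, hA, h⟩ => Or.inr ⟨n, A, hA, hB, h⟩

theorem IsChildSelection.diff_unstarredSet (hstar : IsChildSelection ℱ star) {n : ℕ}
    (hn : IsPurelyAtomic μ (ℱ (n + 1))) {A : Set Ω} (hA : A ∈ atomsOf (ℱ n)) :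
    A \ unstarredSet ℱ star n = star n A := by
  obtain ⟨hs, hsA⟩ := hstar n A hA
  ext x
  refine ⟨?_, fun hx => ⟨hsA hx, ?_⟩⟩
  · rintro ⟨hxA, hxU⟩
    obtain ⟨B, hB, hxB⟩ := hn.exists_mem x
    by_contra hxs
    have hBA : B ⊆ A := subset_of_mem_atomsOf (ℱ.mono n.le_succ) hA hB hxA hxB
    exact hxU ⟨B, ⟨hB, A, hA, hBA, fun hBs => hxs (hBs ▸ hxB)⟩, hxB⟩
  · rintro ⟨B, ⟨hB, A', hA', hBA', hne⟩, hxB⟩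
    obtain rfl : A = A' := eq_of_mem_atomsOf hA hA' (hsA hx) (hBA' hxB)
    exact hne (eq_of_mem_atomsOf hB hs hxB hx)

-- If `B` were unstarred at levels `i < j`, then the atom of `ℱ j` around `B` would be `B` itself,
-- and `B` would be its only child.
theorem IsChildSelection.eq_of_mem_unstarredChildren (hstar : IsChildSelection ℱ star) {i j : ℕ}
    {B : Set Ω} (hi : B ∈ unstarredChildren ℱ star i) (hj : B ∈ unstarredChildren ℱ star j) :
    i = j := by
  wlog hij : i < j generalizing i j
  · rcases (not_lt.1 hij).eq_or_lt with h | h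
    · exact h.symm
    · exact (this hj hi h).symm
  obtain ⟨hBj, A, hA, hBA, hne⟩ := hj
  obtain ⟨x, hx⟩ := hBj.2.1
  have hAB : A ⊆ B := subset_of_mem_atomsOf (ℱ.mono hij) hi.1 hA hx (hBA hx)
  obtain ⟨hs, hsA⟩ := hstar j A hA
  obtain ⟨y, hy⟩ := hs.2.1
  exact absurd (eq_of_mem_atomsOf hBj hs (hAB (hsA hy)) hy) hne

theorem tsum_measure_le_carlesonConst_mul {R : Set (Set Ω)} {I : Set Ω} (hI : I ∈ R)
    (h0 : μ I ≠ 0) (htop : μ I ≠ ∞) :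
    ∑' J : {J : Set Ω // J ∈ R ∧ J ⊆ I}, μ (J : Set Ω) ≤ carlesonConst μ R * μ I := by
  rw [← ENNReal.div_le_iff h0 htop, div_eq_mul_inv, mul_comm]
  exact le_iSup₂ (f := fun I (_ : I ∈ R) =>
    (μ I)⁻¹ * ∑' J : {J : Set Ω // J ∈ R ∧ J ⊆ I}, μ (J : Set Ω)) I hI

theorem measure_unstarredSet_inter_le [SFinite μ] {n k : ℕ} (hkn : k ≤ n + 1)
    (hn : IsPurelyAtomic μ (ℱ (n + 1))) {A : Set Ω} (hA : A ∈ atomsOf (ℱ k)) :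
    μ (unstarredSet ℱ star n ∩ A) ≤
      ∑' B : {B : Set Ω // B ∈ unstarredChildren ℱ star n ∧ B ⊆ A}, μ (B : Set Ω) := by
  have hsub : unstarredSet ℱ star n ∩ A ⊆
      ⋃ B ∈ {B : Set Ω | B ∈ unstarredChildren ℱ star n ∧ B ⊆ A}, B := by
    rintro x ⟨⟨B, hB, hxB⟩, hxA⟩
    exact Set.mem_biUnion (t := id)
      ⟨hB, subset_of_mem_atomsOf (ℱ.mono hkn) hA hB.1 hxA hxB⟩ hxB
  exact (measure_mono hsub).trans (measure_biUnion_le μ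
    ((countable_unstarredChildren hn).mono (Set.sep_subset _ _)) id)

theorem IsChildSelection.tsum_measure_unstarredSet_inter_le [IsFiniteMeasure μ]
    (hstar : IsChildSelection ℱ star) (hℱ : ∀ n, IsPurelyAtomic μ (ℱ n)) {k : ℕ} {B : Set Ω}
    (hB : B ∈ unstarredChildren ℱ star k) :
    ∑' n, μ (unstarredSet ℱ star (k + n) ∩ B) ≤
      carlesonConst μ (unstarredAtoms ℱ star) * μ B := by
  let e : (Σ n, {J : Set Ω // J ∈ unstarredChildren ℱ star (k + n) ∧ J ⊆ B}) →
      {J : Set Ω // J ∈ unstarredAtoms ℱ star ∧ J ⊆ B} := fun q =>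
    ⟨q.2.1, unstarredChildren_subset_unstarredAtoms _ q.2.2.1, q.2.2.2⟩
  have he : Function.Injective e := by
    rintro ⟨n, J, hJ⟩ ⟨n', J', hJ'⟩ h
    obtain rfl : J = J' := congrArg Subtype.val h
    obtain rfl : n = n' := Nat.add_left_cancel (hstar.eq_of_mem_unstarredChildren hJ.1 hJ'.1)
    rfl
  calc ∑' n, μ (unstarredSet ℱ star (k + n) ∩ B)
      ≤ ∑' n, ∑' J : {J : Set Ω // J ∈ unstarredChildren ℱ star (k + n) ∧ J ⊆ B}, μ (J : Set Ω) :=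
        ENNReal.tsum_le_tsum fun n => measure_unstarredSet_inter_le (by omega) (hℱ _) hB.1
    _ = ∑' q, μ (e q : Set Ω) := (ENNReal.tsum_sigma fun n
        (J : {J : Set Ω // J ∈ unstarredChildren ℱ star (k + n) ∧ J ⊆ B}) => μ (J : Set Ω)).symm
    _ ≤ ∑' J : {J : Set Ω // J ∈ unstarredAtoms ℱ star ∧ J ⊆ B}, μ (J : Set Ω) :=
        ENNReal.tsum_comp_le_tsum_of_injective he _
    _ ≤ carlesonConst μ (unstarredAtoms ℱ star) * μ B :=
        tsum_measure_le_carlesonConst_mul (unstarredChildren_subset_unstarredAtoms k hB)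
          ((hℱ _).2 B hB.1).ne' (measure_ne_top μ B)

-- Induction on the number of levels: on an atom `B` of `ℱ (k + 1)` either `B` is unstarred and the
-- Carleson condition at `B` applies, or `B` misses `unstarredSet ℱ star k` and the induction
-- hypothesis at level `k + 1` does.
theorem IsChildSelection.sum_measure_unstarredSet_inter_le [IsFiniteMeasure μ]
    (hstar : IsChildSelection ℱ star) (hℱ : ∀ n, IsPurelyAtomic μ (ℱ n)) (N k : ℕ) {A : Set Ω}
    (hA : MeasurableSet[ℱ k] A) :
    ∑ n ∈ Finset.range N, μ (unstarredSet ℱ star (k + n) ∩ A) ≤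
      carlesonConst μ (unstarredAtoms ℱ star) * μ A := by
  induction N generalizing k A with
  | zero => simp
  | succ N ih =>
    have hA' : MeasurableSet[ℱ (k + 1)] A := ℱ.mono k.le_succ _ hA
    have hatom : ∀ B ∈ atomsOf (ℱ (k + 1)),
        ∑ n ∈ Finset.range (N + 1), μ (unstarredSet ℱ star (k + n) ∩ B) ≤
          carlesonConst μ (unstarredAtoms ℱ star) * μ B := by
      intro B hB
      by_cases hBU : B ∈ unstarredChildren ℱ star k
      · exact (ENNReal.sum_le_tsum _).trans (hstar.tsum_measure_unstarredSet_inter_le hℱ hBU)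
      · have hempty : unstarredSet ℱ star k ∩ B = ∅ := by
          refine Set.eq_empty_of_forall_notMem ?_
          rintro x ⟨⟨B', hB', hxB'⟩, hxB⟩
          exact hBU (eq_of_mem_atomsOf hB'.1 hB hxB' hxB ▸ hB')
        rw [Finset.sum_range_succ', add_zero, hempty, measure_empty, add_zero]
        simpa only [add_assoc, add_comm 1] using ih (k + 1) hB.1
    have hmeas : ∀ {S : Set Ω}, MeasurableSet S →
        (∑ n ∈ Finset.range (N + 1), μ.restrict (unstarredSet ℱ star (k + n))) S =
          ∑ n ∈ Finset.range (N + 1), μ (unstarredSet ℱ star (k + n) ∩ S) := fun hS => by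
      simp only [Measure.finsetSum_apply, Measure.restrict_apply hS, Set.inter_comm]
    rw [← hmeas (ℱ.le _ _ hA')]
    refine (hℱ (k + 1)).measure_le_of_forall_atomsOf (ℱ.le _) (fun B hB => ?_) hA'
      (ν₂ := carlesonConst μ (unstarredAtoms ℱ star) • μ)
    rw [hmeas (ℱ.le _ _ hB.1)]
    exact hatom B hB

theorem IsChildSelection.isCarlesonSequence_unstarredSet [IsFiniteMeasure μ]
    (hstar : IsChildSelection ℱ star) (hℱ : ∀ n, IsPurelyAtomic μ (ℱ n)) :
    IsCarlesonSequence μ ℱ (unstarredSet ℱ star) (carlesonConst μ (unstarredAtoms ℱ star)) :=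
  fun k _ hA => ENNReal.tsum_le_of_sum_range_le fun N =>
    hstar.sum_measure_unstarredSet_inter_le hℱ N k hA

end UnstarredSets

section Domination

variable {Ω : Type u} {m mΩ : MeasurableSpace Ω} {μ : Measure Ω} {ℱ : Filtration ℕ mΩ}
  {star : ℕ → Set Ω → Set Ω} {X : Type v} [NormedAddCommGroup X] [NormedSpace ℝ X]
  [CompleteSpace X]

theorem setLIntegral_enorm_eq_enorm_setIntegral_of_const {D : Ω → X} {S : Set Ω}
    (hS : MeasurableSet S) (hμS : μ S ≠ ∞) (hconst : ∀ x ∈ S, ∀ y ∈ S, D x = D y) :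
    ∫⁻ x in S, ‖D x‖ₑ ∂μ = ‖∫ x in S, D x ∂μ‖ₑ := by
  rcases S.eq_empty_or_nonempty with rfl | ⟨x₀, hx₀⟩
  · simp
  have hD : ∀ x ∈ S, D x = D x₀ := fun x hx => hconst x hx x₀ hx₀
  rw [setIntegral_congr_fun hS hD, setIntegral_const, enorm_smul, measureReal_def,
    Real.enorm_of_nonneg ENNReal.toReal_nonneg, ENNReal.ofReal_toReal hμS,
    setLIntegral_congr_fun hS fun x hx => congrArg enorm (hD x hx), setLIntegral_const, mul_comm]

-- The constant value on `A \ U` has to balance the integral over `A ∩ U`.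
theorem setLIntegral_enorm_le_two_mul_of_setIntegral_eq_zero {D : Ω → X} (hD : Integrable D μ)
    {A U : Set Ω} (hA : MeasurableSet A) (hU : MeasurableSet U) (hμA : μ A ≠ ∞)
    (hconst : ∀ x ∈ A \ U, ∀ y ∈ A \ U, D x = D y) (h0 : ∫ x in A, D x ∂μ = 0) :
    ∫⁻ x in A, ‖D x‖ₑ ∂μ ≤ 2 * ∫⁻ x in A ∩ U, ‖D x‖ₑ ∂μ := by
  have hbalance : ∫ x in A \ U, D x ∂μ = -∫ x in A ∩ U, D x ∂μ :=
    eq_neg_of_add_eq_zero_right ((integral_inter_add_sdiff hU hD.integrableOn).trans h0)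
  calc ∫⁻ x in A, ‖D x‖ₑ ∂μ
      = ∫⁻ x in A ∩ U, ‖D x‖ₑ ∂μ + ∫⁻ x in A \ U, ‖D x‖ₑ ∂μ :=
        (lintegral_inter_add_sdiff _ A hU).symm
    _ = ∫⁻ x in A ∩ U, ‖D x‖ₑ ∂μ + ‖∫ x in A ∩ U, D x ∂μ‖ₑ := by
        rw [setLIntegral_enorm_eq_enorm_setIntegral_of_const (hA.diff hU)
          (measure_ne_top_of_subset Set.sdiff_subset hμA) hconst, hbalance, enorm_neg]
    _ ≤ 2 * ∫⁻ x in A ∩ U, ‖D x‖ₑ ∂μ := by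
        rw [two_mul]
        gcongr
        exact enorm_integral_le_lintegral_enorm _

theorem IsChildSelection.setLIntegral_enorm_le_two_mul [IsFiniteMeasure μ]
    (hstar : IsChildSelection ℱ star) (hℱ : ∀ n, IsPurelyAtomic μ (ℱ n)) {n : ℕ} {D : Ω → X}
    (hD : StronglyMeasurable[ℱ (n + 1)] D) (hint : Integrable D μ)
    (h0 : ∀ A ∈ atomsOf (ℱ n), ∫ x in A, D x ∂μ = 0) {S : Set Ω} (hS : MeasurableSet[ℱ n] S) :
    ∫⁻ x in S, ‖D x‖ₑ ∂μ ≤ 2 * ∫⁻ x in S ∩ unstarredSet ℱ star n, ‖D x‖ₑ ∂μ := by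
  set U := unstarredSet ℱ star n with hUdef
  have hU : MeasurableSet U := ℱ.le _ _ (measurableSet_unstarredSet (hℱ (n + 1)))
  have hν₁ : ∀ {A}, MeasurableSet[ℱ n] A →
      (μ.withDensity fun x => ‖D x‖ₑ) A = ∫⁻ x in A, ‖D x‖ₑ ∂μ :=
    fun hA => withDensity_apply _ (ℱ.le n _ hA)
  have hν₂ : ∀ {A}, MeasurableSet[ℱ n] A →
      ((2 : ℝ≥0∞) • (μ.restrict U).withDensity fun x => ‖D x‖ₑ) A =
        2 * ∫⁻ x in A ∩ U, ‖D x‖ₑ ∂μ := fun hA => by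
    rw [Measure.smul_apply, smul_eq_mul, withDensity_apply _ (ℱ.le n _ hA),
      Measure.restrict_restrict (ℱ.le n _ hA)]
  rw [← hν₁ hS, ← hν₂ hS]
  refine (hℱ n).measure_le_of_forall_atomsOf (ℱ.le n) (fun A hA => ?_) hS
  rw [hν₁ hA.1, hν₂ hA.1]
  refine setLIntegral_enorm_le_two_mul_of_setIntegral_eq_zero hint (ℱ.le n _ hA.1) hU
    (measure_ne_top μ A) (fun x hx y hy => ?_) (h0 A hA)
  rw [hUdef, hstar.diff_unstarredSet (hℱ (n + 1)) hA] at hx hy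
  exact apply_eq_of_mem_atomsOf hD (hstar n A hA).1 hy hx

theorem lintegral_mul_le_mul_setLIntegral_mul (hm : m ≤ mΩ) {d g : Ω → ℝ≥0∞} (hd : Measurable d)
    (hg : Measurable[m] g) {C : ℝ≥0∞} {U : Set Ω}
    (h : ∀ S, MeasurableSet[m] S → ∫⁻ x in S, d x ∂μ ≤ C * ∫⁻ x in S ∩ U, d x ∂μ) :
    ∫⁻ x, d x * g x ∂μ ≤ C * ∫⁻ x in U, d x * g x ∂μ := by
  have hg' : Measurable g := hg.mono hm le_rfl
  have hdensity (ν : Measure Ω) : ∫⁻ x, d x * g x ∂ν = ∫⁻ x, g x ∂ν.withDensity d :=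
    (lintegral_withDensity_eq_lintegral_mul ν hd hg').symm
  rw [hdensity, hdensity, ← smul_eq_mul, ← lintegral_smul_measure]
  refine lintegral_le_lintegral_of_forall_measurableSet hm (fun S hS => ?_) hg
  rw [Measure.smul_apply, withDensity_apply _ (hm S hS), withDensity_apply _ (hm S hS),
    Measure.restrict_restrict (hm S hS)]
  exact h S hS

end Domination

section PowerInequalities

variable {p : ℝ}

theorem ofReal_mul_mul_rpow_sub_one_le (hp : 1 ≤ p) (a s : ℝ≥0∞) :
    ENNReal.ofReal p * (a * s ^ (p - 1)) ≤ a ^ p + ENNReal.ofReal (p - 1) * s ^ p := by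
  rcases hp.eq_or_lt with rfl | hp
  · simp
  have hpq : p.HolderConjugate p.conjExponent := Real.HolderConjugate.conjExponent hp
  have hp0 : ENNReal.ofReal p ≠ 0 := ENNReal.ofReal_ne_zero_iff.2 hpq.pos
  calc ENNReal.ofReal p * (a * s ^ (p - 1))
      ≤ ENNReal.ofReal p * (a ^ p / ENNReal.ofReal p +
          (s ^ (p - 1)) ^ p.conjExponent / ENNReal.ofReal p.conjExponent) := by
        gcongr
        exact ENNReal.young_inequality _ _ hpq
    _ = a ^ p + ENNReal.ofReal (p - 1) * s ^ p := by
        rw [mul_add, ENNReal.mul_div_cancel hp0 ENNReal.ofReal_ne_top, ← ENNReal.rpow_mul,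
          hpq.sub_one_mul_conj, ← hpq.div_conj_eq_sub_one,
          ENNReal.ofReal_div_of_pos hpq.symm.pos, ENNReal.mul_comm_div]

theorem ofReal_mul_mul_rpow_sub_one_le_weighted (hp1 : 1 ≤ p) (hp2 : p ≤ 2) {L : ℝ≥0∞}
    (hL0 : L ≠ 0) (hL : L ≠ ∞) (a s : ℝ≥0∞) :
    ENNReal.ofReal p * (a * s ^ (p - 1)) ≤ L ^ (p - 1) * a ^ p + L⁻¹ * s ^ p := by
  have hp0 : 0 < p := by linarith
  have hp1' : 0 ≤ p - 1 := by linarith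
  have hcancel : L ^ ((p - 1) / p) * L⁻¹ ^ ((p - 1) / p) = 1 := by
    rw [← ENNReal.mul_rpow_of_nonneg _ _ (by positivity), ENNReal.mul_inv_cancel hL0 hL,
      ENNReal.one_rpow]
  calc ENNReal.ofReal p * (a * s ^ (p - 1))
      = ENNReal.ofReal p * ((L ^ ((p - 1) / p) * a) * (L⁻¹ ^ (1 / p) * s) ^ (p - 1)) := by
        rw [ENNReal.mul_rpow_of_nonneg _ _ hp1', ← ENNReal.rpow_mul, one_div_mul_eq_div,
          mul_mul_mul_comm, hcancel, one_mul]
    _ ≤ (L ^ ((p - 1) / p) * a) ^ p + ENNReal.ofReal (p - 1) * (L⁻¹ ^ (1 / p) * s) ^ p :=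
        ofReal_mul_mul_rpow_sub_one_le hp1 _ _
    _ ≤ (L ^ ((p - 1) / p) * a) ^ p + 1 * (L⁻¹ ^ (1 / p) * s) ^ p := by
        gcongr
        exact ENNReal.ofReal_le_one.2 (by linarith)
    _ = L ^ (p - 1) * a ^ p + L⁻¹ * s ^ p := by
        rw [one_mul, ENNReal.mul_rpow_of_nonneg _ _ hp0.le, ENNReal.mul_rpow_of_nonneg _ _ hp0.le,
          ← ENNReal.rpow_mul, ← ENNReal.rpow_mul, div_mul_cancel₀ _ hp0.ne',
          div_mul_cancel₀ _ hp0.ne', ENNReal.rpow_one]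

theorem mul_rpow_sub_one (hp : 1 ≤ p) (a : ℝ≥0∞) : a * a ^ (p - 1) = a ^ p := by
  have h := ENNReal.rpow_add_of_nonneg (x := a) 1 (p - 1) zero_le_one (by linarith)
  rwa [ENNReal.rpow_one, add_sub_cancel, eq_comm] at h

theorem add_rpow_le_rpow_add_mul (hp : 1 ≤ p) (s a : ℝ≥0∞) :
    (s + a) ^ p ≤ s ^ p + ENNReal.ofReal p * (a * (s + a) ^ (p - 1)) := by
  have hp0 : 0 < p := by linarith
  by_cases htop : s + a = ∞
  · rcases ENNReal.add_eq_top.1 htop with rfl | rfl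
    · simp [hp0]
    · rw [add_top, mul_rpow_sub_one hp, ENNReal.top_rpow_of_pos hp0,
        ENNReal.mul_top (ENNReal.ofReal_ne_zero_iff.2 hp0), add_top]
  refine ENNReal.le_of_add_le_add_left (a := ENNReal.ofReal (p - 1) * (s + a) ^ p)
    (ENNReal.mul_ne_top ENNReal.ofReal_ne_top (ENNReal.rpow_ne_top_of_nonneg hp0.le htop)) ?_
  calc ENNReal.ofReal (p - 1) * (s + a) ^ p + (s + a) ^ p
      = ENNReal.ofReal p * ((s + a) * (s + a) ^ (p - 1)) := by
        rw [mul_rpow_sub_one hp, ← add_one_mul, ← ENNReal.ofReal_one,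
          ← ENNReal.ofReal_add (by linarith) zero_le_one, sub_add_cancel]
    _ = ENNReal.ofReal p * (s * (s + a) ^ (p - 1)) +
          ENNReal.ofReal p * (a * (s + a) ^ (p - 1)) := by ring
    _ ≤ s ^ p + ENNReal.ofReal (p - 1) * (s + a) ^ p +
          ENNReal.ofReal p * (a * (s + a) ^ (p - 1)) := by
        gcongr
        exact ofReal_mul_mul_rpow_sub_one_le hp _ _
    _ = _ := by ring

theorem add_rpow_le_rpow_add_mul_add_mul (hp1 : 1 ≤ p) (hp2 : p ≤ 2) (s a : ℝ≥0∞) :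
    (s + a) ^ p ≤ s ^ p + ENNReal.ofReal p * (a * s ^ (p - 1) + a ^ p) := by
  refine (add_rpow_le_rpow_add_mul hp1 s a).trans ?_
  gcongr
  calc a * (s + a) ^ (p - 1) ≤ a * (s ^ (p - 1) + a ^ (p - 1)) := by
        gcongr
        exact ENNReal.rpow_add_le_add_rpow s a (by linarith) (by linarith)
    _ = a * s ^ (p - 1) + a ^ p := by rw [mul_add, mul_rpow_sub_one hp1]

theorem sum_range_succ_rpow_le (hp1 : 1 ≤ p) (hp2 : p ≤ 2) (a : ℕ → ℝ≥0∞) (N : ℕ) :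
    (∑ k ∈ Finset.range (N + 1), a k) ^ p ≤ ENNReal.ofReal p *
      (∑ n ∈ Finset.range N, a (n + 1) * (∑ k ∈ Finset.range (n + 1), a k) ^ (p - 1) +
        ∑ k ∈ Finset.range (N + 1), a k ^ p) := by
  induction N with
  | zero => simpa using le_mul_of_one_le_left' (ENNReal.one_le_ofReal.2 hp1)
  | succ N ih =>
    rw [Finset.sum_range_succ a (N + 1), Finset.sum_range_succ (fun n => a (n + 1) * _) N,
      Finset.sum_range_succ (fun k => a k ^ p) (N + 1), add_add_add_comm, mul_add]
    exact (add_rpow_le_rpow_add_mul_add_mul hp1 hp2 _ _).trans (add_le_add_left ih _)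

end PowerInequalities

section MainEstimate

variable {Ω : Type*} {m mΩ : MeasurableSpace Ω} {μ : Measure Ω} {ℱ : Filtration ℕ mΩ}
  {U : ℕ → Set Ω} {c : ℝ≥0∞} {p : ℝ} {d : ℕ → Ω → ℝ≥0∞}

theorem measurable_sum_range_succ_of_adapted (hd : ∀ n, Measurable[ℱ n] (d n)) (n : ℕ) :
    Measurable[ℱ n] fun x => ∑ k ∈ Finset.range (n + 1), d k x :=
  Finset.measurable_sum _ fun k hk =>
    (hd k).mono (ℱ.mono (Nat.lt_succ_iff.1 (Finset.mem_range.1 hk))) le_rfl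

theorem lintegral_sum_rpow_ne_top (hp : 1 ≤ p) (hd : ∀ n, Measurable (d n)) {s : Finset ℕ}
    (hfin : ∀ n ∈ s, ∫⁻ x, d n x ^ p ∂μ ≠ ∞) : ∫⁻ x, (∑ n ∈ s, d n x) ^ p ∂μ ≠ ∞ := by
  refine ne_top_of_le_ne_top ?_
    (lintegral_mono fun x => ENNReal.rpow_sum_le_const_mul_sum_rpow s (fun n => d n x) hp)
  rw [lintegral_const_mul _ (Finset.measurable_sum _ fun n _ => (hd n).pow_const p),
    lintegral_finsetSum _ fun n _ => (hd n).pow_const p]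
  exact ENNReal.mul_ne_top (ENNReal.rpow_ne_top_of_nonneg (by linarith) (ENNReal.natCast_ne_top _))
    (ENNReal.sum_ne_top.2 hfin)

theorem lintegral_sum_range_succ_rpow_le (hp1 : 1 ≤ p) (hp2 : p ≤ 2)
    (hd : ∀ n, Measurable (d n)) (N : ℕ) :
    ∫⁻ x, (∑ k ∈ Finset.range (N + 1), d k x) ^ p ∂μ ≤ ENNReal.ofReal p *
      (∑ n ∈ Finset.range N,
          ∫⁻ x, d (n + 1) x * (∑ k ∈ Finset.range (n + 1), d k x) ^ (p - 1) ∂μ +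
        ∑ k ∈ Finset.range (N + 1), ∫⁻ x, d k x ^ p ∂μ) := by
  have hpow : ∀ n, Measurable fun x => d n x ^ p := fun n => (hd n).pow_const p
  have hcross : ∀ n, Measurable fun x =>
      d (n + 1) x * (∑ k ∈ Finset.range (n + 1), d k x) ^ (p - 1) := fun n =>
    (hd _).mul ((Finset.measurable_sum _ fun k _ => hd k).pow_const _)
  refine (lintegral_mono fun x => sum_range_succ_rpow_le hp1 hp2 (fun k => d k x) N).trans_eq ?_
  rw [lintegral_const_mul' _ _ ENNReal.ofReal_ne_top,
    lintegral_add_left (Finset.measurable_sum _ fun n _ => hcross n),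
    lintegral_finsetSum _ fun n _ => hcross n, lintegral_finsetSum _ fun n _ => hpow n]

theorem ofReal_mul_lintegral_mul_rpow_sub_one_le (hm : m ≤ mΩ) (hp1 : 1 ≤ p)
    (hp2 : p ≤ 2) {L : ℝ≥0∞} (hL0 : L ≠ 0) (hL : L ≠ ∞) {a h : Ω → ℝ≥0∞}
    (ha : Measurable a) (hh : Measurable[m] h) {V : Set Ω}
    (hdom : ∀ S, MeasurableSet[m] S → ∫⁻ x in S, a x ∂μ ≤ 2 * ∫⁻ x in S ∩ V, a x ∂μ) :
    ENNReal.ofReal p * ∫⁻ x, a x * h x ^ (p - 1) ∂μ ≤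
      2 * (L ^ (p - 1) * ∫⁻ x, a x ^ p ∂μ + L⁻¹ * ∫⁻ x in V, h x ^ p ∂μ) :=
  calc ENNReal.ofReal p * ∫⁻ x, a x * h x ^ (p - 1) ∂μ
      ≤ ENNReal.ofReal p * (2 * ∫⁻ x in V, a x * h x ^ (p - 1) ∂μ) := by
        gcongr
        exact lintegral_mul_le_mul_setLIntegral_mul hm ha (hh.pow_const _) hdom
    _ = 2 * ∫⁻ x in V, ENNReal.ofReal p * (a x * h x ^ (p - 1)) ∂μ := by
        rw [lintegral_const_mul' _ _ ENNReal.ofReal_ne_top, mul_left_comm]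
    _ ≤ 2 * ∫⁻ x in V, (L ^ (p - 1) * a x ^ p + L⁻¹ * h x ^ p) ∂μ := by
        gcongr with x
        exact ofReal_mul_mul_rpow_sub_one_le_weighted hp1 hp2 hL0 hL _ _
    _ = 2 * (L ^ (p - 1) * ∫⁻ x in V, a x ^ p ∂μ + L⁻¹ * ∫⁻ x in V, h x ^ p ∂μ) := by
        rw [lintegral_add_left ((ha.pow_const _).const_mul _),
          lintegral_const_mul _ (ha.pow_const _),
          lintegral_const_mul' _ _ (ENNReal.inv_ne_top.2 hL0)]
    _ ≤ _ := by
        gcongr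
        exact Measure.restrict_le_self

theorem IsCarlesonSequence.sum_lintegral_mul_rpow_sub_one_le (hU : IsCarlesonSequence μ ℱ U c)
    (hp1 : 1 ≤ p) (hp2 : p ≤ 2) {L : ℝ≥0∞} (hL0 : L ≠ 0) (hL : L ≠ ∞)
    (hd : ∀ n, Measurable[ℱ n] (d n))
    (hdom : ∀ n S, MeasurableSet[ℱ n] S →
      ∫⁻ x in S, d (n + 1) x ∂μ ≤ 2 * ∫⁻ x in S ∩ U n, d (n + 1) x ∂μ) (N : ℕ) :
    ENNReal.ofReal p * ∑ n ∈ Finset.range N,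
        ∫⁻ x, d (n + 1) x * (∑ k ∈ Finset.range (n + 1), d k x) ^ (p - 1) ∂μ ≤
      2 * (L ^ (p - 1) * ∑ k ∈ Finset.range (N + 1), ∫⁻ x, d k x ^ p ∂μ +
        L⁻¹ * (c * ∫⁻ x, (∑ k ∈ Finset.range (N + 1), d k x) ^ p ∂μ)) := by
  set H : ℕ → Ω → ℝ≥0∞ := fun n x => ∑ k ∈ Finset.range (n + 1), d k x
  have hH : ∀ n, Measurable[ℱ n] (H n) := measurable_sum_range_succ_of_adapted hd
  have hHmono : Monotone fun n x => H n x ^ p := fun i j hij x =>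
    ENNReal.rpow_le_rpow (Finset.sum_le_sum_of_subset (Finset.range_mono (Nat.succ_le_succ hij)))
      (by linarith)
  have hd' : ∀ n, Measurable (d n) := fun n => (hd n).mono (ℱ.le n) le_rfl
  rw [Finset.mul_sum]
  refine (Finset.sum_le_sum fun n _ => ofReal_mul_lintegral_mul_rpow_sub_one_le (ℱ.le n)
    hp1 hp2 hL0 hL (hd' _) (hH n) (hdom n)).trans ?_
  rw [← Finset.mul_sum, Finset.sum_add_distrib, ← Finset.mul_sum, ← Finset.mul_sum,
    Finset.sum_range_succ' _ N]
  gcongr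
  · exact le_self_add
  · exact hU.sum_setLIntegral_le_of_monotone (fun n => (hH n).pow_const p) hHmono N

theorem two_mul_inv_four_mul_add_one_mul_le (c : ℝ≥0∞) : 2 * ((4 * c + 1)⁻¹ * c) ≤ 2⁻¹ := by
  rw [ENNReal.le_inv_iff_mul_le]
  calc 2 * ((4 * c + 1)⁻¹ * c) * 2 = (4 * c + 1)⁻¹ * (4 * c) := by ring
    _ ≤ (4 * c + 1)⁻¹ * (4 * c + 1) := by gcongr; exact le_self_add
    _ ≤ 1 := ENNReal.inv_mul_le_one _

theorem le_two_mul_of_le_half_add {a b : ℝ≥0∞} (ha : a ≠ ∞) (h : a ≤ a / 2 + b) : a ≤ 2 * b := by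
  have hhalf : a / 2 ≤ b := by
    refine ENNReal.le_of_add_le_add_left (ENNReal.div_ne_top ha two_ne_zero) ?_
    rwa [ENNReal.add_halves]
  calc a = 2 * (a / 2) := (ENNReal.mul_div_cancel two_ne_zero ENNReal.ofNat_ne_top).symm
    _ ≤ 2 * b := by gcongr

-- Choosing `L = 4 * c + 1` in Young's inequality gives the left-hand side the coefficient
-- `2 * L⁻¹ * c ≤ 1 / 2` on the right, so that it can be absorbed.
theorem IsCarlesonSequence.lintegral_sum_rpow_le (hU : IsCarlesonSequence μ ℱ U c) (hc : c ≠ ∞)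
    (hp1 : 1 ≤ p) (hp2 : p ≤ 2) (hd : ∀ n, Measurable[ℱ n] (d n))
    (hdom : ∀ n S, MeasurableSet[ℱ n] S →
      ∫⁻ x in S, d (n + 1) x ∂μ ≤ 2 * ∫⁻ x in S ∩ U n, d (n + 1) x ∂μ) (N : ℕ) :
    ∫⁻ x, (∑ k ∈ Finset.range (N + 1), d k x) ^ p ∂μ ≤
      8 * (4 * c + 1) ^ (p - 1) * ∑ k ∈ Finset.range (N + 1), ∫⁻ x, d k x ^ p ∂μ := by
  set L : ℝ≥0∞ := 4 * c + 1
  set Y : ℝ≥0∞ := ∫⁻ x, (∑ k ∈ Finset.range (N + 1), d k x) ^ p ∂μ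
  set e : ℝ≥0∞ := ∑ k ∈ Finset.range (N + 1), ∫⁻ x, d k x ^ p ∂μ
  have hL1 : 1 ≤ L := le_add_self
  have hL0 : L ≠ 0 := (zero_lt_one.trans_le hL1).ne'
  have hL : L ≠ ∞ := ENNReal.add_ne_top.2 ⟨ENNReal.mul_ne_top (by norm_num) hc, ENNReal.one_ne_top⟩
  have hQ1 : 1 ≤ L ^ (p - 1) := by
    simpa only [ENNReal.one_rpow] using ENNReal.rpow_le_rpow hL1 (sub_nonneg.2 hp1)
  have hd' : ∀ n, Measurable (d n) := fun n => (hd n).mono (ℱ.le n) le_rfl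
  by_cases hfin : e = ∞
  · rw [hfin, ENNReal.mul_top (mul_ne_zero (by norm_num) (zero_lt_one.trans_le hQ1).ne')]
    exact le_top
  have hY : Y ≠ ∞ := lintegral_sum_rpow_ne_top hp1 hd' (ENNReal.sum_ne_top.1 hfin)
  have habsorb : Y ≤ Y / 2 + 4 * L ^ (p - 1) * e :=
    calc Y ≤ 2 * (L ^ (p - 1) * e + L⁻¹ * (c * Y)) + ENNReal.ofReal p * e :=
          (lintegral_sum_range_succ_rpow_le hp1 hp2 hd' N).trans <| by
            rw [mul_add]
            exact add_le_add_left (hU.sum_lintegral_mul_rpow_sub_one_le hp1 hp2 hL0 hL hd hdom N) _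
      _ ≤ 2 * (L ^ (p - 1) * e + L⁻¹ * (c * Y)) + 2 * L ^ (p - 1) * e := by
          gcongr
          exact (ENNReal.ofReal_le_ofNat.2 hp2).trans (le_mul_of_one_le_right' hQ1)
      _ = 2 * (L⁻¹ * c) * Y + 4 * L ^ (p - 1) * e := by ring
      _ ≤ Y / 2 + 4 * L ^ (p - 1) * e := by
          rw [ENNReal.div_eq_inv_mul]
          gcongr
          exact two_mul_inv_four_mul_add_one_mul_le c
  exact (le_two_mul_of_le_half_add hY habsorb).trans_eq (by ring)

end MainEstimate

section Levy

open Filter Topology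

variable {Ω : Type*} {mΩ : MeasurableSpace Ω} {μ : Measure Ω} [IsFiniteMeasure μ]
  {ℱ : Filtration ℕ mΩ} {X : Type*} [NormedAddCommGroup X] [NormedSpace ℝ X] [CompleteSpace X]

theorem tendsto_eLpNorm_condExp_sub_iff {f : Ω → X} (hf : Integrable f μ) :
    Tendsto (fun n => eLpNorm (μ[f | ℱ n] - f) 1 μ) atTop (𝓝 0) ↔
      Tendsto (fun n => condExpL1CLM X (ℱ.le n) μ (hf.toL1 f)) atTop (𝓝 (hf.toL1 f)) := by
  rw [Lp.tendsto_Lp_iff_tendsto_eLpNorm']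
  exact tendsto_congr fun n => eLpNorm_congr_ae
    ((condExp_ae_eq_condExpL1CLM (ℱ.le n) hf).sub hf.coeFn_toL1.symm)

theorem isClosed_setOf_tendsto_eLpNorm_condExp_sub :
    IsClosed {f : Ω →₁[μ] X |
      Tendsto (fun n => eLpNorm (μ[f | ℱ n] - ⇑f) 1 μ) atTop (𝓝 0)} := by
  simp only [tendsto_eLpNorm_condExp_sub_iff (L1.integrable_coeFn _), Integrable.toL1_coeFn]
  refine Equicontinuous.isClosed_setOfPred_tendsto
    (UniformEquicontinuous.equicontinuous <|
      LipschitzWith.uniformEquicontinuous _ 1 fun n => ?_) continuous_id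
  exact ContinuousLinearMap.lipschitzWith_of_opNorm_le (L1.norm_setToL1_le _ zero_le_one)

theorem tendsto_eLpNorm_condExp_indicator_const_sub
    (hsup : ⨆ n, (ℱ n : MeasurableSpace Ω) = mΩ) {s : Set Ω} (hs : MeasurableSet s) (c : X) :
    Tendsto (fun n => eLpNorm (μ[s.indicator fun _ => c | ℱ n] - s.indicator fun _ => c) 1 μ)
      atTop (𝓝 0) := by
  let T : ℝ →L[ℝ] X := ContinuousLinearMap.toSpanSingleton ℝ c
  let g : Ω → ℝ := s.indicator 1
  have hg : Integrable g μ := (integrable_const 1).indicator hs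
  have hgm : StronglyMeasurable[⨆ n, (ℱ n : MeasurableSpace Ω)] g := by
    rw [hsup]
    exact stronglyMeasurable_one.indicator hs
  have hTg : (s.indicator fun _ => c) = T ∘ g := by
    ext x
    by_cases hx : x ∈ s <;> simp [T, g, hx]
  have hreal : Tendsto (fun n => ‖T‖₊ * eLpNorm (μ[g | ℱ n] - g) 1 μ) atTop (𝓝 0) := by
    simpa only [mul_zero] using
      ENNReal.Tendsto.const_mul (hg.tendsto_eLpNorm_condExp hgm) (Or.inr ENNReal.coe_ne_top)
  refine tendsto_of_tendsto_of_tendsto_of_le_of_le tendsto_const_nhds hreal (fun _ => zero_le)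
    fun n => eLpNorm_le_nnreal_smul_eLpNorm_of_ae_le_mul ?_ 1
  rw [hTg]
  filter_upwards [T.comp_condExp_comm (m := ℱ n) hg] with x hx
  rw [Pi.sub_apply, ← hx, Function.comp_apply, Function.comp_apply, ← map_sub]
  exact T.le_opNNNorm _

-- Lévy's upward theorem. Mathlib has it for real functions, which gives the case of indicators.
theorem tendsto_eLpNorm_condExp_sub (hsup : ⨆ n, (ℱ n : MeasurableSpace Ω) = mΩ) {f : Ω → X}
    (hf : Integrable f μ) :
    Tendsto (fun n => eLpNorm (μ[f | ℱ n] - f) 1 μ) atTop (𝓝 0) := by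
  refine Integrable.induction (μ := μ)
    (P := fun f => Tendsto (fun n => eLpNorm (μ[f | ℱ n] - f) 1 μ) atTop (𝓝 0))
    (fun c s hs _ => tendsto_eLpNorm_condExp_indicator_const_sub hsup hs c)
    (fun f g _ hf hg hflim hglim => ?_) isClosed_setOf_tendsto_eLpNorm_condExp_sub
    (fun f g hfg _ hlim => hlim.congr fun n => eLpNorm_congr_ae ((condExp_congr_ae hfg).sub hfg)) hf
  rw [tendsto_eLpNorm_condExp_sub_iff hf] at hflim
  rw [tendsto_eLpNorm_condExp_sub_iff hg] at hglim
  rw [tendsto_eLpNorm_condExp_sub_iff (hf.add hg), Integrable.toL1_add _ _ hf hg]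
  simpa only [map_add] using hflim.add hglim

theorem eLpNorm_le_of_forall_eLpNorm_condExp_le (hsup : ⨆ n, (ℱ n : MeasurableSpace Ω) = mΩ)
    {f : Ω → X} (hf : Integrable f μ) {q K : ℝ≥0∞} (hK : ∀ n, eLpNorm (μ[f | ℱ n]) q μ ≤ K) :
    eLpNorm f q μ ≤ K := by
  obtain ⟨ns, -, hns⟩ := (tendstoInMeasure_of_tendsto_eLpNorm one_ne_zero
    (fun n => (integrable_condExp (m := ℱ n)).1) hf.1
      (tendsto_eLpNorm_condExp_sub hsup hf)).exists_seq_tendsto_ae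
  exact Lp.eLpNorm_le_of_ae_tendsto (Eventually.of_forall fun n => hK (ns n))
    (fun n => integrable_condExp.1) hns

end Levy

section MartingaleDifferences

variable {Ω : Type u} {mΩ : MeasurableSpace Ω} {μ : Measure Ω} {ℱ : Filtration ℕ mΩ}
  {X : Type v} [NormedAddCommGroup X] {p : ℝ}

theorem eLpNorm_ofReal_rpow (hp : 0 < p) (f : Ω → X) :
    eLpNorm f (ENNReal.ofReal p) μ ^ p = ∫⁻ x, ‖f x‖ₑ ^ p ∂μ := by
  rw [eLpNorm_eq_lintegral_rpow_enorm_toReal (by simpa using hp) ENNReal.ofReal_ne_top,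
    ENNReal.toReal_ofReal hp.le, ← ENNReal.rpow_mul, one_div, inv_mul_cancel₀ hp.ne',
    ENNReal.rpow_one]

variable [NormedSpace ℝ X]

/-- The difference sequence of the martingale `n ↦ μ[f | ℱ n]`. Its entry at `0` is `μ[f | ℱ 0]`, so
that its partial sums, taken from `0`, are the martingale itself. -/
noncomputable def martingaleDiff (μ : Measure Ω) (ℱ : Filtration ℕ mΩ) (f : Ω → X) :
    ℕ → Ω → X
  | 0 => μ[f | ℱ 0]
  | n + 1 => μ[f | ℱ (n + 1)] - μ[f | ℱ n]

theorem sum_range_succ_martingaleDiff (f : Ω → X) (n : ℕ) :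
    ∑ k ∈ Finset.range (n + 1), martingaleDiff μ ℱ f k = μ[f | ℱ n] := by
  induction n with
  | zero => simp [martingaleDiff]
  | succ n ih => rw [Finset.sum_range_succ, ih, martingaleDiff, add_sub_cancel]

theorem stronglyMeasurable_martingaleDiff (f : Ω → X) :
    ∀ n, StronglyMeasurable[ℱ n] (martingaleDiff μ ℱ f n)
  | 0 => stronglyMeasurable_condExp
  | n + 1 => stronglyMeasurable_condExp.sub
      (stronglyMeasurable_condExp.mono (ℱ.mono n.le_succ))

variable [CompleteSpace X]

theorem integrable_martingaleDiff (f : Ω → X) : ∀ n, Integrable (martingaleDiff μ ℱ f n) μ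
  | 0 => integrable_condExp
  | _ + 1 => integrable_condExp.sub integrable_condExp

theorem setIntegral_martingaleDiff_succ [IsFiniteMeasure μ] {f : Ω → X} (hf : Integrable f μ)
    (n : ℕ) {A : Set Ω} (hA : MeasurableSet[ℱ n] A) :
    ∫ x in A, martingaleDiff μ ℱ f (n + 1) x ∂μ = 0 := by
  simp only [martingaleDiff, Pi.sub_apply]
  rw [integral_sub integrable_condExp.integrableOn integrable_condExp.integrableOn,
    setIntegral_condExp (ℱ.le _) hf hA, setIntegral_condExp (ℱ.le _) hf (ℱ.mono n.le_succ _ hA),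
    sub_self]

theorem martingaleDiffNorm_eq_tsum [IsProbabilityMeasure μ] (hℱ : ℱ 0 = ⊥) (hp : 0 < p)
    (f : Ω → X) : martingaleDiffNorm μ ℱ p f =
      (∑' n, eLpNorm (martingaleDiff μ ℱ f n) (ENNReal.ofReal p) μ ^ p) ^ (1 / p) := by
  rw [tsum_eq_zero_add' ENNReal.summable, martingaleDiff, hℱ, condExp_bot,
    eLpNorm_const' _ (by simpa using hp) ENNReal.ofReal_ne_top, measure_univ, ENNReal.one_rpow,
    mul_one]
  rfl

theorem eLpNorm_le_mul_martingaleDiffNorm_of_forall_condExp [IsProbabilityMeasure μ]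
    (hℱ : IsFilteredProbabilitySpace μ ℱ) (hp : 0 < p) {f : Ω → X} (hf : Integrable f μ)
    {K : ℝ≥0∞} (h : ∀ n, eLpNorm (μ[f | ℱ n]) (ENNReal.ofReal p) μ ^ p ≤
      K * ∑ k ∈ Finset.range (n + 1), eLpNorm (martingaleDiff μ ℱ f k) (ENNReal.ofReal p) μ ^ p) :
    eLpNorm f (ENNReal.ofReal p) μ ≤ K ^ (1 / p) * martingaleDiffNorm μ ℱ p f := by
  refine eLpNorm_le_of_forall_eLpNorm_condExp_le hℱ.iSup_eq hf fun n => ?_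
  rw [martingaleDiffNorm_eq_tsum hℱ.zero_eq hp, ← ENNReal.mul_rpow_of_nonneg _ _ (by positivity),
    one_div, ENNReal.le_rpow_inv_iff hp]
  exact (h n).trans (by gcongr; exact ENNReal.sum_le_tsum _)

end MartingaleDifferences

section HilbertSpace

theorem enorm_add_rpow_add_enorm_sub_rpow_le {H : Type*} [NormedAddCommGroup H]
    [InnerProductSpace ℝ H] {p : ℝ} (hp0 : 0 < p) (hp2 : p ≤ 2) (x y : H) :
    ‖x + y‖ₑ ^ p + ‖x - y‖ₑ ^ p ≤ 2 * (‖x‖ₑ ^ p + ‖y‖ₑ ^ p) := by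
  have hq : 1 ≤ 2 / p := (one_le_div hp0).2 hp2
  have hpow : ∀ a : ℝ≥0∞, (a ^ p) ^ (2 / p) = a ^ 2 := fun a => by
    rw [← ENNReal.rpow_mul, mul_div_cancel₀ _ hp0.ne', ENNReal.rpow_two]
  have hlaw : ‖x + y‖ₑ ^ 2 + ‖x - y‖ₑ ^ 2 = 2 * (‖x‖ₑ ^ 2 + ‖y‖ₑ ^ 2) := by
    simp only [enorm_eq_nnnorm]
    norm_cast
    exact NNReal.eq (parallelogram_law_with_norm ℝ x y)
  rw [← ENNReal.rpow_le_rpow_iff (zero_lt_one.trans_le hq)]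
  calc (‖x + y‖ₑ ^ p + ‖x - y‖ₑ ^ p) ^ (2 / p)
      ≤ 2 ^ (2 / p - 1) * ((‖x + y‖ₑ ^ p) ^ (2 / p) + (‖x - y‖ₑ ^ p) ^ (2 / p)) :=
        ENNReal.rpow_add_le_mul_rpow_add_rpow _ _ hq
    _ = 2 ^ (2 / p - 1) * 2 * (‖x‖ₑ ^ 2 + ‖y‖ₑ ^ 2) := by rw [hpow, hpow, hlaw, mul_assoc]
    _ = 2 ^ (2 / p) * (‖x‖ₑ ^ 2 + ‖y‖ₑ ^ 2) := by
        rw [ENNReal.rpow_sub _ _ two_ne_zero ENNReal.ofNat_ne_top, ENNReal.rpow_one,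
          ENNReal.div_mul_cancel two_ne_zero ENNReal.ofNat_ne_top]
    _ = 2 ^ (2 / p) * ((‖x‖ₑ ^ p) ^ (2 / p) + (‖y‖ₑ ^ p) ^ (2 / p)) := by rw [hpow, hpow]
    _ ≤ 2 ^ (2 / p) * (‖x‖ₑ ^ p + ‖y‖ₑ ^ p) ^ (2 / p) := by
        gcongr
        exact ENNReal.add_rpow_le_rpow_add _ _ hq
    _ = (2 * (‖x‖ₑ ^ p + ‖y‖ₑ ^ p)) ^ (2 / p) :=
        (ENNReal.mul_rpow_of_nonneg _ _ (by positivity)).symm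

variable {Ω : Type*} {m mΩ : MeasurableSpace Ω} {μ : Measure Ω} {ℱ : Filtration ℕ mΩ}
  {H : Type*} [NormedAddCommGroup H] [InnerProductSpace ℝ H] {p : ℝ}

theorem eLpNorm_add_rpow_add_eLpNorm_sub_rpow_le (hp0 : 0 < p) (hp2 : p ≤ 2) {f g : Ω → H}
    (hf : AEStronglyMeasurable f μ) (hg : AEStronglyMeasurable g μ) :
    eLpNorm (f + g) (ENNReal.ofReal p) μ ^ p + eLpNorm (f - g) (ENNReal.ofReal p) μ ^ p ≤
      2 * (eLpNorm f (ENNReal.ofReal p) μ ^ p + eLpNorm g (ENNReal.ofReal p) μ ^ p) := by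
  simp only [eLpNorm_ofReal_rpow hp0]
  rw [← lintegral_add_left' ((hf.add hg).enorm.pow_const p),
    ← lintegral_add_left' (hf.enorm.pow_const p), ← lintegral_const_mul' _ _ ENNReal.ofNat_ne_top]
  exact lintegral_mono fun x => enorm_add_rpow_add_enorm_sub_rpow_le hp0 hp2 (f x) (g x)

variable [CompleteSpace H]

theorem eLpNorm_rpow_le_condExp_add_sub_condExp [IsFiniteMeasure μ] (hp1 : 1 ≤ p) (hp2 : p ≤ 2)
    (hm : m ≤ mΩ) {g : Ω → H} (hg : Integrable g μ) :
    eLpNorm g (ENNReal.ofReal p) μ ^ p ≤ eLpNorm (μ[g | m]) (ENNReal.ofReal p) μ ^ p +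
      2 * eLpNorm (g - μ[g | m]) (ENNReal.ofReal p) μ ^ p := by
  have hp0 : 0 < p := by linarith
  have hh : Integrable (μ[g | m]) μ := integrable_condExp
  set a := eLpNorm (μ[g | m]) (ENNReal.ofReal p) μ ^ p
  by_cases ha : a = ∞
  · simp only [ha, top_add, le_top]
  -- `g` and its reflection `μ[g | m] - (g - μ[g | m])` have the same conditional expectation.
  have hreflect : a ≤ eLpNorm (μ[g | m] - (g - μ[g | m])) (ENNReal.ofReal p) μ ^ p := by
    have hcond : μ[μ[g | m] - (g - μ[g | m]) | m] =ᵐ[μ] μ[g | m] := by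
      have hself : μ[μ[g | m] | m] = μ[g | m] :=
        condExp_of_stronglyMeasurable hm stronglyMeasurable_condExp hh
      filter_upwards [condExp_sub hh (hg.sub hh) m, condExp_sub hg hh m] with x hx hx'
      rw [hx, Pi.sub_apply, hx', Pi.sub_apply, hself, sub_self, sub_zero]
    refine ENNReal.rpow_le_rpow ((eLpNorm_congr_ae hcond).symm.trans_le ?_) hp0.le
    exact eLpNorm_condExp_le_eLpNorm _ (by simpa using hp1)
  refine ENNReal.le_of_add_le_add_right ha ?_
  calc eLpNorm g (ENNReal.ofReal p) μ ^ p + a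
      ≤ eLpNorm (μ[g | m] + (g - μ[g | m])) (ENNReal.ofReal p) μ ^ p +
          eLpNorm (μ[g | m] - (g - μ[g | m])) (ENNReal.ofReal p) μ ^ p := by
        rw [add_sub_cancel]
        gcongr
    _ ≤ 2 * (a + eLpNorm (g - μ[g | m]) (ENNReal.ofReal p) μ ^ p) :=
        eLpNorm_add_rpow_add_eLpNorm_sub_rpow_le hp0 hp2 hh.1 (hg.sub hh).1
    _ = a + 2 * eLpNorm (g - μ[g | m]) (ENNReal.ofReal p) μ ^ p + a := by ring

theorem eLpNorm_condExp_rpow_le_two_mul_sum [IsFiniteMeasure μ] (hp1 : 1 ≤ p) (hp2 : p ≤ 2)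
    (f : Ω → H) (n : ℕ) :
    eLpNorm (μ[f | ℱ n]) (ENNReal.ofReal p) μ ^ p ≤
      2 * ∑ k ∈ Finset.range (n + 1),
        eLpNorm (martingaleDiff μ ℱ f k) (ENNReal.ofReal p) μ ^ p := by
  induction n with
  | zero =>
    rw [Finset.sum_range_one, martingaleDiff]
    exact le_mul_of_one_le_left' one_le_two
  | succ n ih =>
    have htower : μ[μ[f | ℱ (n + 1)] | ℱ n] =ᵐ[μ] μ[f | ℱ n] :=
      condExp_condExp_of_le (ℱ.mono n.le_succ) (ℱ.le _)
    have hstep := eLpNorm_rpow_le_condExp_add_sub_condExp hp1 hp2 (ℱ.le n)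
      (integrable_condExp (μ := μ) (m := ℱ (n + 1)) (f := f))
    rw [eLpNorm_congr_ae htower, eLpNorm_congr_ae (Filter.EventuallyEq.rfl.sub htower)] at hstep
    rw [Finset.sum_range_succ, mul_add]
    exact hstep.trans (by gcongr; exact le_rfl)

theorem martingaleTypeConst_le_of_innerProductSpace (hp1 : 1 ≤ p) (hp2 : p ≤ 2) :
    martingaleTypeConst.{u} p H ≤ 2 ^ (1 / p) :=
  sInf_le fun _ _ _ _ _ hℱ f hf => eLpNorm_le_mul_martingaleDiffNorm_of_forall_condExp hℱ
    (by linarith) (hf.integrable (by simpa using hp1))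
    (eLpNorm_condExp_rpow_le_two_mul_sum hp1 hp2 f)

end HilbertSpace

section Constants

variable {p : ℝ}

theorem eight_le_upperConst_factor (hp : 1 ≤ p) :
    8 ≤ (2 + 1 / (1 - (2 : ℝ) ^ (-(1 / p)))) * (2 : ℝ) ^ (2 - 1 / p) := by
  have hp0 : 0 < p := by linarith
  have hinv : 1 / p ≤ 1 := (div_le_one hp0).2 hp
  have hinv0 : 0 < 1 / p := by positivity
  have hlarge : 2 ≤ (2 : ℝ) ^ (2 - 1 / p) :=
    Real.self_le_rpow_of_one_le one_le_two (by linarith)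
  have hhalf : 2⁻¹ ≤ (2 : ℝ) ^ (-(1 / p)) := by
    rw [← Real.rpow_neg_one]
    exact Real.rpow_le_rpow_of_exponent_le one_le_two (by linarith)
  have hlt : (2 : ℝ) ^ (-(1 / p)) < 1 :=
    Real.rpow_lt_one_of_one_lt_of_neg one_lt_two (by linarith)
  have hfrac : 2 ≤ 1 / (1 - (2 : ℝ) ^ (-(1 / p))) := by
    rw [le_div_iff₀ (by linarith)]
    linarith
  nlinarith

theorem eight_mul_rpow_le_upperConst (hp : 1 ≤ p) (M c : ℝ≥0∞) :
    8 * (4 * c + 1) ^ (1 - 1 / p) ≤ upperConst p M c := by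
  have h8 : 8 ≤ ENNReal.ofReal ((2 + 1 / (1 - (2 : ℝ) ^ (-(1 / p)))) * (2 : ℝ) ^ (2 - 1 / p)) :=
    ENNReal.ofNat_le_ofReal.2 (eight_le_upperConst_factor hp)
  have h1 : 1 ≤ (1 + M ^ p) ^ (1 / p) := ENNReal.one_le_rpow le_self_add (by positivity)
  rw [upperConst]
  gcongr
  exact h8.trans (le_mul_of_one_le_right' h1)

theorem upperConst_lt_top (hp : 1 ≤ p) {M c : ℝ≥0∞} (hM : M < ∞) (hc : c < ∞) :
    upperConst p M c < ∞ := by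
  have hp0 : 0 < p := by linarith
  have hinv : 1 / p ≤ 1 := (div_le_one hp0).2 hp
  have hMp : 1 + M ^ p ≠ ∞ :=
    ENNReal.add_ne_top.2 ⟨ENNReal.one_ne_top, ENNReal.rpow_ne_top_of_nonneg hp0.le hM.ne⟩
  have hc4 : 4 * c + 1 ≠ ∞ :=
    ENNReal.add_ne_top.2 ⟨ENNReal.mul_ne_top ENNReal.ofNat_ne_top hc.ne, ENNReal.one_ne_top⟩
  exact ENNReal.mul_lt_top (ENNReal.mul_lt_top ENNReal.ofReal_lt_top
    (ENNReal.rpow_lt_top_of_nonneg (by positivity) hMp))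
    (ENNReal.rpow_lt_top_of_nonneg (by linarith) hc4)

theorem eight_mul_rpow_sub_one_rpow_one_div_le (hp : 1 ≤ p) (L : ℝ≥0∞) :
    (8 * L ^ (p - 1)) ^ (1 / p) ≤ 8 * L ^ (1 - 1 / p) := by
  have hp0 : 0 < p := by linarith
  have hinv : 1 / p ≤ 1 := (div_le_one hp0).2 hp
  rw [ENNReal.mul_rpow_of_nonneg _ _ (by positivity), ← ENNReal.rpow_mul, sub_mul, one_mul,
    mul_one_div_cancel hp0.ne']
  gcongr
  simpa only [ENNReal.rpow_one] using
    ENNReal.rpow_le_rpow_of_exponent_le (x := 8) (by norm_num) hinv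

end Constants

section BanachSpace

variable {Ω : Type u} {mΩ : MeasurableSpace Ω} {μ : Measure Ω} {ℱ : Filtration ℕ mΩ}
  {star : ℕ → Set Ω → Set Ω} {X : Type v} [NormedAddCommGroup X] [NormedSpace ℝ X]
  [CompleteSpace X] {p : ℝ}

theorem IsChildSelection.eLpNorm_condExp_rpow_le [IsFiniteMeasure μ]
    (hstar : IsChildSelection ℱ star) (hℱ : ∀ n, IsPurelyAtomic μ (ℱ n))
    (hE : carlesonConst μ (unstarredAtoms ℱ star) ≠ ∞) (hp1 : 1 ≤ p) (hp2 : p ≤ 2) {f : Ω → X}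
    (hf : Integrable f μ) (n : ℕ) :
    eLpNorm (μ[f | ℱ n]) (ENNReal.ofReal p) μ ^ p ≤
      8 * (4 * carlesonConst μ (unstarredAtoms ℱ star) + 1) ^ (p - 1) *
        ∑ k ∈ Finset.range (n + 1), eLpNorm (martingaleDiff μ ℱ f k) (ENNReal.ofReal p) μ ^ p := by
  have hp0 : 0 < p := by linarith
  simp only [eLpNorm_ofReal_rpow hp0]
  have hnorm : ∀ x, ‖(μ[f | ℱ n]) x‖ₑ ≤
      ∑ k ∈ Finset.range (n + 1), ‖martingaleDiff μ ℱ f k x‖ₑ := fun x => by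
    rw [← sum_range_succ_martingaleDiff, Finset.sum_apply]
    exact enorm_sum_le _ _
  refine (lintegral_mono fun x => ENNReal.rpow_le_rpow (hnorm x) hp0.le).trans ?_
  refine (hstar.isCarlesonSequence_unstarredSet hℱ).lintegral_sum_rpow_le hE hp1 hp2
    (fun k => (stronglyMeasurable_martingaleDiff f k).enorm) (fun k S hS => ?_) n
  exact hstar.setLIntegral_enorm_le_two_mul hℱ (stronglyMeasurable_martingaleDiff f (k + 1))
    (integrable_martingaleDiff f (k + 1))
    (fun A hA => setIntegral_martingaleDiff_succ hf k hA.1) hS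

theorem IsChildSelection.eLpNorm_le_mul_martingaleDiffNorm [IsProbabilityMeasure μ]
    (hstar : IsChildSelection ℱ star) (hℱ : IsFilteredProbabilitySpace μ ℱ)
    (hE : carlesonConst μ (unstarredAtoms ℱ star) ≠ ∞) (hp1 : 1 ≤ p) (hp2 : p ≤ 2) {f : Ω → X}
    (hf : Integrable f μ) :
    eLpNorm f (ENNReal.ofReal p) μ ≤
      8 * (4 * carlesonConst μ (unstarredAtoms ℱ star) + 1) ^ (1 - 1 / p) *
        martingaleDiffNorm μ ℱ p f :=
  (eLpNorm_le_mul_martingaleDiffNorm_of_forall_condExp hℱ (by linarith) hf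
    (hstar.eLpNorm_condExp_rpow_le hℱ.purelyAtomic hE hp1 hp2 hf)).trans
    (mul_le_mul_left (eight_mul_rpow_sub_one_rpow_one_div_le hp1 _) _)

end BanachSpace

theorem theorem3_general {Ω : Type u} {mΩ : MeasurableSpace Ω} (μ : Measure Ω)
    [IsProbabilityMeasure μ] (ℱ : Filtration ℕ mΩ) (hℱ : IsFilteredProbabilitySpace μ ℱ)
    (star : ℕ → Set Ω → Set Ω) (hstar : IsChildSelection ℱ star)
    (p : ℝ) (hp1 : 1 ≤ p) (hp2 : p ≤ 2)
    (hE : carlesonConst μ (unstarredAtoms ℱ star) < ∞) :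
    upperConst p (martingaleTypeConst.{u, 0} p ℝ)
        (carlesonConst μ (unstarredAtoms ℱ star)) < ∞ ∧
      ∀ (X : Type v) [NormedAddCommGroup X] [NormedSpace ℝ X] [CompleteSpace X] (f : Ω → X),
        Integrable f μ →
          eLpNorm f (ENNReal.ofReal p) μ ≤
            upperConst p (martingaleTypeConst.{u, 0} p ℝ)
              (carlesonConst μ (unstarredAtoms ℱ star)) * martingaleDiffNorm μ ℱ p f := by
  have hMT : martingaleTypeConst.{u, 0} p ℝ < ∞ :=
    (martingaleTypeConst_le_of_innerProductSpace hp1 hp2).trans_lt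
      (ENNReal.rpow_lt_top_of_nonneg (by positivity) ENNReal.ofNat_ne_top)
  exact ⟨upperConst_lt_top hp1 hMT hE, fun X _ _ _ f hf =>
    (hstar.eLpNorm_le_mul_martingaleDiffNorm hℱ hE.ne hp1 hp2 hf).trans
      (mul_le_mul_left (eight_mul_rpow_le_upperConst hp1 _ _) _)⟩

theorem theorem3 {Ω : Type u} {mΩ : MeasurableSpace Ω} (μ : Measure Ω) [IsProbabilityMeasure μ]
    (ℱ : Filtration ℕ mΩ) (hℱ : IsFilteredProbabilitySpace μ ℱ)
    (star : ℕ → Set Ω → Set Ω) (hstar : IsLargestChild μ ℱ star)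
    (p : ℝ) (hp1 : 1 < p) (hp2 : p ≤ 2)
    (hE : carlesonConst μ (unstarredAtoms ℱ star) < ∞) :
    upperConst p (martingaleTypeConst.{u, 0} p ℝ)
        (carlesonConst μ (unstarredAtoms ℱ star)) < ∞ ∧
      ∀ (X : Type v) [NormedAddCommGroup X] [NormedSpace ℝ X] [CompleteSpace X] (f : Ω → X),
        MemLp f (ENNReal.ofReal p) μ →
          eLpNorm f (ENNReal.ofReal p) μ ≤
            upperConst p (martingaleTypeConst.{u, 0} p ℝ)
              (carlesonConst μ (unstarredAtoms ℱ star)) * martingaleDiffNorm μ ℱ p f := by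
  have h := theorem3_general μ ℱ hℱ star hstar.isChildSelection p hp1.le hp2 hE
  exact ⟨h.1, fun X _ _ _ f hf => h.2 X f (hf.integrable (by simpa using hp1.le))⟩
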